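/- An interior algebra is a Boolean algebra $A$ with an operator $g\colon A\to A$ such that $g(1)=1$, $g(a\cdot b)=g(a)\cdot g(b)$, $g(a)\le a$ and $g(g(a))=g(a)$ for all $a,b\in A$; homomorphisms are Boolean homomorphisms commuting with $g$. Let $\mathcal{O}$ be the functor from the category of interior algebras to the category of Heyting algebras that sends $A$ to the Heyting algebra $A^\circ=\{a\in A: g(a)=a\}$ of its open elements, which is a bounded sublattice of $A$ with implication $a\Rightarrow b=g(-a+b)$, and sends a homomorphism $h\colon A\to B$ to its restriction $h^\circ=h\restriction A^\circ\colon A^\circ\to B^\circ$. For a variety $\mathbf{V}$ of interior algebras, regarded as a full subcategory of the category of interior algebras, let $\gamma(\mathbf{V})$ be the class of all Heyting algebras isomorphic to $\mathcal{O}(A)$ for some $A\in\mathbf{V}$, regarded as a full subcategory of the category of Heyting algebras. An interior algebra is a $^*$-algebra if it is generated by its open elements; $\mathbf{V}$ is a $^*$-variety if $\mathbf{V}$ is the variety generated by the $^*$-algebras in $\mathbf{V}$; and $\mathbf{V}$ is locally finite if every finitely generated subalgebra of each algebra in $\mathbf{V}$ is finite. Theorem. Let $\mathbf{V}$ be a variety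 of interior algebras. Then the restriction of $\mathcal{O}$ to $\mathbf{V}$ is full (that is, for all $A,B\in\mathbf{V}$ every Heyting homomorphism $\mathcal{O}(A)\to\mathcal{O}(B)$ equals $\mathcal{O}(h)$ for some homomorphism $h\colon A\to B$) if and only if $\mathbf{V}$ is a locally finite $^*$-variety. In this case, $\mathbf{V}$ and $\gamma(\mathbf{V})$ are categorically equivalent, that is, there is a full and faithful functor $F\colon\mathbf{V}\to\gamma(\mathbf{V})$ such that every object of $\gamma(\mathbf{V})$ is isomorphic to $F(A)$ for some $A\in\mathbf{V}$. -/

import Mathlib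

open CategoryTheory

universe u v w

/-- An interior algebra: a Boolean algebra with an interior operator. -/
class InteriorAlgebra (α : Type u) extends BooleanAlgebra α where
  /-- The interior operator. -/
  int : α → α
  int_top : int ⊤ = ⊤
  int_inf : ∀ a b : α, int (a ⊓ b) = int a ⊓ int b
  int_le : ∀ a : α, int a ≤ a
  int_int : ∀ a : α, int (int a) = int a

namespace InteriorAlgebra

variable {α : Type u} [InteriorAlgebra α]

theorem int_mono {a b : α} (h : a ≤ b) : int a ≤ int b := by
  have h1 := int_inf a b
  rw [inf_eq_left.mpr h] at h1
  exact inf_eq_left.mp h1.symm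

theorem int_bot : int (⊥ : α) = ⊥ := le_bot_iff.mp (int_le _)

variable (α) in
/-- The open elements, i.e. the fixed points of the interior operator. -/
def Opens : Type u := {a : α // int a = a}

namespace Opens

instance : PartialOrder (Opens α) := inferInstanceAs (PartialOrder {a : α // int a = a})

/-- The Heyting algebra of open elements: the order and the bounded lattice operations are those
of the ambient algebra, and the implication is `a ⇨ b = int (aᶜ ⊔ b)`. -/
instance : HeytingAlgebra (Opens α) where
  sup a b := ⟨a.1 ⊔ b.1, le_antisymm (int_le _) (sup_le
    (a.2.symm.le.trans (int_mono le_sup_left)) (b.2.symm.le.trans (int_mono le_sup_right)))⟩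
  le_sup_left a b := (le_sup_left : a.1 ≤ a.1 ⊔ b.1)
  le_sup_right a b := (le_sup_right : b.1 ≤ a.1 ⊔ b.1)
  sup_le a b c h₁ h₂ := (sup_le h₁ h₂ : a.1 ⊔ b.1 ≤ c.1)
  inf a b := ⟨a.1 ⊓ b.1, by rw [int_inf, a.2, b.2]⟩
  inf_le_left a b := (inf_le_left : a.1 ⊓ b.1 ≤ a.1)
  inf_le_right a b := (inf_le_right : a.1 ⊓ b.1 ≤ b.1)
  le_inf a b c h₁ h₂ := (le_inf h₁ h₂ : a.1 ≤ b.1 ⊓ c.1)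
  top := ⟨⊤, int_top⟩
  le_top a := (le_top : a.1 ≤ ⊤)
  bot := ⟨⊥, int_bot⟩
  bot_le a := (bot_le : ⊥ ≤ a.1)
  himp a b := ⟨int (a.1ᶜ ⊔ b.1), int_int _⟩
  compl a := ⟨int (a.1ᶜ), int_int _⟩
  le_himp_iff a b c := by
    have key : a.1 ≤ b.1ᶜ ⊔ c.1 ↔ a.1 ⊓ b.1 ≤ c.1 := by
      rw [sup_comm, ← himp_eq, le_himp_iff]
    change a.1 ≤ int (b.1ᶜ ⊔ c.1) ↔ a.1 ⊓ b.1 ≤ c.1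
    rw [← key]
    exact ⟨fun h => h.trans (int_le _), fun h => a.2.symm.le.trans (int_mono h)⟩
  himp_bot a := Subtype.ext (congrArg int (sup_bot_eq a.1ᶜ))

end Opens

/-- A set closed under all operations of interior algebras. -/
structure IsSubalgebra (S : Set α) : Prop where
  bot_mem : ⊥ ∈ S
  top_mem : ⊤ ∈ S
  sup_mem : ∀ {a b : α}, a ∈ S → b ∈ S → a ⊔ b ∈ S
  inf_mem : ∀ {a b : α}, a ∈ S → b ∈ S → a ⊓ b ∈ S
  compl_mem : ∀ {a : α}, a ∈ S → aᶜ ∈ S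
  int_mem : ∀ {a : α}, a ∈ S → int a ∈ S

/-- The (universe of the) subalgebra generated by a set. -/
def generated (s : Set α) : Set α := ⋂₀ {S | IsSubalgebra S ∧ s ⊆ S}

variable (α) in
/-- A `*`-algebra is an interior algebra that is generated by its open elements. -/
def IsStarAlgebra : Prop := generated {a : α | int a = a} = Set.univ

end InteriorAlgebra

/-- A homomorphism of interior algebras: a homomorphism of bounded lattices (hence of Boolean
algebras) that commutes with the interior operators. -/
structure InteriorHom (α : Type u) (β : Type v) [InteriorAlgebra α] [InteriorAlgebra β]
    extends BoundedLatticeHom α β where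
  map_int' : ∀ a : α, toFun (InteriorAlgebra.int a) = InteriorAlgebra.int (toFun a)

namespace InteriorHom

open InteriorAlgebra

variable {α : Type u} {β : Type v} {γ : Type w}
  [InteriorAlgebra α] [InteriorAlgebra β] [InteriorAlgebra γ]

theorem ext {f g : InteriorHom α β} (h : f.toBoundedLatticeHom = g.toBoundedLatticeHom) :
    f = g := by
  cases f; cases g; cases h; rfl

theorem map_int (f : InteriorHom α β) (a : α) :
    f.toBoundedLatticeHom (int a) = int (f.toBoundedLatticeHom a) := f.map_int' a

variable (α) in
/-- The identity homomorphism. -/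
def id : InteriorHom α α where
  toBoundedLatticeHom := BoundedLatticeHom.id α
  map_int' _ := rfl

/-- Composition of homomorphisms. -/
def comp (g : InteriorHom β γ) (f : InteriorHom α β) : InteriorHom α γ where
  toBoundedLatticeHom := g.toBoundedLatticeHom.comp f.toBoundedLatticeHom
  map_int' a := (congrArg g.toBoundedLatticeHom (f.map_int a)).trans (g.map_int _)

/-- The restriction of a homomorphism to the Heyting algebras of open elements. -/
def restrictOpens (f : InteriorHom α β) : HeytingHom (Opens α) (Opens β) where
  toFun a := ⟨f.toBoundedLatticeHom a.1, by rw [← f.map_int, a.2]⟩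
  map_sup' a b := Subtype.ext (map_sup f.toBoundedLatticeHom a.1 b.1)
  map_inf' a b := Subtype.ext (map_inf f.toBoundedLatticeHom a.1 b.1)
  map_bot' := Subtype.ext (map_bot f.toBoundedLatticeHom)
  map_himp' a b := Subtype.ext (by
    change f.toBoundedLatticeHom (int (a.1ᶜ ⊔ b.1)) =
      int ((f.toBoundedLatticeHom a.1)ᶜ ⊔ f.toBoundedLatticeHom b.1)
    rw [f.map_int, map_sup, map_compl'])

end InteriorHom

/-- Bundled interior algebras. -/
structure IntAlg : Type (u + 1) where
  carrier : Type u
  [str : InteriorAlgebra carrier]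

namespace IntAlg

instance : CoeSort IntAlg.{u} (Type u) := ⟨IntAlg.carrier⟩

instance (A : IntAlg.{u}) : InteriorAlgebra A := A.str

/-- The category of interior algebras and their homomorphisms. -/
instance : Category.{u} IntAlg.{u} where
  Hom A B := InteriorHom A B
  id A := InteriorHom.id A
  comp f g := InteriorHom.comp g f

/-- The functor of open elements, from interior algebras to Heyting algebras. -/
def openFunctor : IntAlg.{u} ⥤ HeytAlg.{u} where
  obj A := HeytAlg.of (InteriorAlgebra.Opens A)
  map f := HeytAlg.ofHom (InteriorHom.restrictOpens f)
  map_id _ := rfl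
  map_comp _ _ := rfl

/-- Terms of the language of interior algebras, in countably many variables. -/
inductive Term : Type
  | var (n : ℕ) : Term
  | bot : Term
  | top : Term
  | sup (s t : Term) : Term
  | inf (s t : Term) : Term
  | compl (t : Term) : Term
  | int (t : Term) : Term

/-- The value of a term under an assignment of the variables. -/
def Term.eval {α : Type u} [InteriorAlgebra α] (x : ℕ → α) : Term → α
  | .var n => x n
  | .bot => ⊥
  | .top => ⊤
  | .sup s t => s.eval x ⊔ t.eval x
  | .inf s t => s.eval x ⊓ t.eval x
  | .compl t => (t.eval x)ᶜ
  | .int t => InteriorAlgebra.int (t.eval x)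

/-- The algebra satisfies the identity `s ≈ t`. -/
def Satisfies (A : IntAlg.{u}) (s t : Term) : Prop :=
  ∀ x : ℕ → A, s.eval x = t.eval x

/-- A variety of interior algebras: a class of interior algebras defined by identities. -/
def IsVariety (V : ObjectProperty IntAlg.{u}) : Prop :=
  ∃ E : Set (Term × Term), ∀ A : IntAlg.{u}, V A ↔ ∀ e ∈ E, A.Satisfies e.1 e.2

/-- The variety generated by a class: the least variety that contains it. -/
def varietyGenerated (K : ObjectProperty IntAlg.{u}) : ObjectProperty IntAlg.{u} :=
  fun A => ∀ W : ObjectProperty IntAlg.{u}, IsVariety W → (∀ B, K B → W B) → W A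

/-- The variety `V*` generated by the `*`-algebras in `V`. -/
def starPart (V : ObjectProperty IntAlg.{u}) : ObjectProperty IntAlg.{u} :=
  varietyGenerated fun A => V A ∧ InteriorAlgebra.IsStarAlgebra A

/-- `V` is a `*`-variety if `V = V*`. -/
def IsStarVariety (V : ObjectProperty IntAlg.{u}) : Prop := V = starPart V

/-- In every algebra of the class, finitely generated subalgebras are finite. -/
def IsLocallyFinite (V : ObjectProperty IntAlg.{u}) : Prop :=
  ∀ A : IntAlg.{u}, V A → ∀ s : Set A, s.Finite → (InteriorAlgebra.generated s).Finite

/-- The class of the Heyting algebras of open elements of the algebras in `V`, up to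
isomorphism. -/
def gamma (V : ObjectProperty IntAlg.{u}) : ObjectProperty HeytAlg.{u} :=
  fun L => ∃ A : IntAlg.{u}, V A ∧ Nonempty (openFunctor.obj A ≅ L)

end IntAlg

/-- Categorical equivalence: there is a full and faithful functor such that each object of the
target is isomorphic to the image of an object of the source. -/
def CategoricallyEquivalent (C : Type (u + 1)) [Category.{u} C] (D : Type (u + 1))
    [Category.{u} D] : Prop :=
  ∃ F : C ⥤ D, F.Full ∧ F.Faithful ∧ ∀ d : D, ∃ c : C, Nonempty (F.obj c ≅ d)

/-! Both sides of the equivalence amount to every algebra of `V` being a `*`-algebra. In a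
`*`-algebra each element is a finite join of differences of open elements. So homomorphisms out of
it are determined by their values on opens, and every Heyting homomorphism of opens extends
(`IsStarAlgebra.exists_restrictOpens_eq`); hence full and faithful.

Full implies `*`: the subalgebra generated by the opens of `A` has the same opens, and a lift of
their identification forces it to be all of `A`.

`*` implies locally finite: if ultrafilters had unbounded depth, some sequence in `ℕ → A` would need
unboundedly many differences of opens, although this power is a `*`-algebra too. So depth is
bounded, and a finitely generated algebra has finitely many ultrafilters of each bounded depth.

Locally finite `*`-variety implies `*`: all `*`-algebras satisfy the Grzegorczyk inequality, which
is an identity and so passes to `V`; with it, every element of a finite subalgebra is generated by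
opens. -/

namespace InteriorAlgebra

variable {α : Type u} [InteriorAlgebra α]

/-! ### Generated subalgebras -/

theorem subset_generated (s : Set α) : s ⊆ generated s :=
  Set.subset_sInter fun _ h => h.2

theorem generated_subset {s S : Set α} (hS : IsSubalgebra S) (h : s ⊆ S) : generated s ⊆ S :=
  Set.sInter_subset_of_mem ⟨hS, h⟩

theorem isSubalgebra_generated (s : Set α) : IsSubalgebra (generated s) where
  bot_mem := fun _ h => h.1.bot_mem
  top_mem := fun _ h => h.1.top_mem
  sup_mem := fun ha hb S h => h.1.sup_mem (ha S h) (hb S h)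
  inf_mem := fun ha hb S h => h.1.inf_mem (ha S h) (hb S h)
  compl_mem := fun ha S h => h.1.compl_mem (ha S h)
  int_mem := fun ha S h => h.1.int_mem (ha S h)

theorem le_int {u a : α} (hu : int u = u) (h : u ≤ a) : u ≤ int a :=
  hu.symm.le.trans (int_mono h)

/-- A property of the elements of a `*`-algebra holds everywhere once it holds for open elements
and is preserved by complements and joins. -/
theorem IsStarAlgebra.induction (hα : IsStarAlgebra α) {p : α → Prop}
    (isOpen : ∀ a, int a = a → p a) (compl : ∀ a, p a → p aᶜ)
    (sup : ∀ a b, p a → p b → p (a ⊔ b)) (a : α) : p a := by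
  have hS : IsSubalgebra {a | p a} :=
    { bot_mem := isOpen _ int_bot
      top_mem := isOpen _ int_top
      sup_mem := fun ha hb => sup _ _ ha hb
      inf_mem := fun {a b} ha hb => by
        have := compl _ (sup _ _ (compl _ ha) (compl _ hb))
        simpa using this
      compl_mem := fun ha => compl _ ha
      int_mem := fun _ => isOpen _ (int_int _) }
  have h : a ∈ generated {a : α | int a = a} := by rw [hα]; trivial
  exact generated_subset hS (fun a ha => isOpen a ha) h

theorem isSublattice_isOpen : IsSublattice {a : α | int a = a} where
  supClosed := fun a ha b hb => (max (α := Opens α) ⟨a, ha⟩ ⟨b, hb⟩).2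
  infClosed := fun a ha b hb => (min (α := Opens α) ⟨a, ha⟩ ⟨b, hb⟩).2

/-- Interiors are open, so the opens generate the algebra by Boolean operations alone, and they form
a bounded sublattice. -/
theorem IsStarAlgebra.exists_sup_sdiff (hα : IsStarAlgebra α) (a : α) :
    ∃ t : Finset ({a : α | int a = a} × {a : α | int a = a}),
      a = t.sup fun x => x.1.1 \ x.2.1 := by
  rw [← BooleanSubalgebra.mem_closure_iff_sup_sdiff isSublattice_isOpen int_bot int_top]
  exact hα.induction (p := fun a => a ∈ BooleanSubalgebra.closure {a : α | int a = a})
    (fun _ h => BooleanSubalgebra.subset_closure h) (fun _ => BooleanSubalgebra.compl_mem)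
    (fun _ _ => BooleanSubalgebra.sup_mem) a

/-- The generated subalgebra as a Boolean subalgebra. -/
def generatedSubalgebra (s : Set α) : BooleanSubalgebra α where
  carrier := generated s
  supClosed' _ ha _ hb := (isSubalgebra_generated s).sup_mem ha hb
  infClosed' _ ha _ hb := (isSubalgebra_generated s).inf_mem ha hb
  compl_mem' ha := (isSubalgebra_generated s).compl_mem ha
  bot_mem' := (isSubalgebra_generated s).bot_mem

instance (s : Set α) : InteriorAlgebra (generatedSubalgebra s) where
  int a := ⟨int a.1, (isSubalgebra_generated s).int_mem a.2⟩
  int_top := Subtype.ext int_top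
  int_inf a b := Subtype.ext (int_inf a.1 b.1)
  int_le a := int_le a.1
  int_int a := Subtype.ext (int_int a.1)

/-- The inclusion of a generated subalgebra. -/
def generatedInclusion (s : Set α) : InteriorHom (generatedSubalgebra s) α where
  toBoundedLatticeHom := (generatedSubalgebra s).subtype
  map_int' _ := rfl

theorem generated_preimage (s : Set α) :
    generated (Subtype.val ⁻¹' s : Set (generatedSubalgebra s)) = Set.univ := by
  set G := generated (Subtype.val ⁻¹' s : Set (generatedSubalgebra s))
  have hG : IsSubalgebra G := isSubalgebra_generated _
  have hS : IsSubalgebra (Subtype.val '' G) :=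
    { bot_mem := ⟨_, hG.bot_mem, rfl⟩
      top_mem := ⟨_, hG.top_mem, rfl⟩
      sup_mem := by rintro _ _ ⟨a, ha, rfl⟩ ⟨b, hb, rfl⟩; exact ⟨_, hG.sup_mem ha hb, rfl⟩
      inf_mem := by rintro _ _ ⟨a, ha, rfl⟩ ⟨b, hb, rfl⟩; exact ⟨_, hG.inf_mem ha hb, rfl⟩
      compl_mem := by rintro _ ⟨a, ha, rfl⟩; exact ⟨_, hG.compl_mem ha, rfl⟩
      int_mem := by rintro _ ⟨a, ha, rfl⟩; exact ⟨_, hG.int_mem ha, rfl⟩ }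
  refine Set.eq_univ_of_forall fun a => ?_
  obtain ⟨b, hb, hba⟩ := generated_subset hS
    (fun x hx => ⟨⟨x, subset_generated s hx⟩, subset_generated _ hx, rfl⟩) a.2
  rwa [← Subtype.ext hba]

theorem isStarAlgebra_generatedSubalgebra :
    IsStarAlgebra (generatedSubalgebra {a : α | int a = a}) := by
  have h := generated_preimage {a : α | int a = a}
  have e : (Subtype.val ⁻¹' {a : α | int a = a} :
      Set (generatedSubalgebra {a : α | int a = a})) = {a | int a = a} := by
    ext a
    exact (Subtype.ext_iff (a1 := InteriorAlgebra.int a) (a2 := a)).symm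
  rwa [e] at h

instance {ι : Type v} : InteriorAlgebra (ι → α) where
  int a i := int (a i)
  int_top := funext fun _ => int_top
  int_inf a b := funext fun i => int_inf (a i) (b i)
  int_le a i := int_le (a i)
  int_int a := funext fun i => int_int (a i)

/-- The evaluation at a coordinate as a homomorphism. -/
def evalHom {ι : Type v} (i : ι) : InteriorHom (ι → α) α where
  toFun a := a i
  map_sup' _ _ := rfl
  map_inf' _ _ := rfl
  map_top' := rfl
  map_bot' := rfl
  map_int' _ := rfl

/-! ### Ultrafilters -/

variable (α) in
/-- An ultrafilter of the underlying Boolean algebra. -/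
@[ext]
structure Point where
  /-- The elements of the ultrafilter. -/
  carrier : Set α
  top_mem' : ⊤ ∈ carrier
  inf_mem_iff' : ∀ a b, a ⊓ b ∈ carrier ↔ a ∈ carrier ∧ b ∈ carrier
  compl_mem_iff' : ∀ a, aᶜ ∈ carrier ↔ a ∉ carrier

namespace Point

instance : SetLike (Point α) α where
  coe := carrier
  coe_injective _ _ h := Point.ext h

variable {x y : Point α} {a b : α}

@[simp] theorem top_mem : ⊤ ∈ x := x.top_mem'

@[simp] theorem inf_mem_iff : a ⊓ b ∈ x ↔ a ∈ x ∧ b ∈ x := x.inf_mem_iff' a b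

@[simp] theorem compl_mem_iff : aᶜ ∈ x ↔ a ∉ x := x.compl_mem_iff' a

@[simp] theorem bot_notMem : ⊥ ∉ x := by rw [← compl_mem_iff]; simp

@[simp] theorem sup_mem_iff : a ⊔ b ∈ x ↔ a ∈ x ∨ b ∈ x := by
  rw [← compl_compl (a ⊔ b), compl_sup]
  simp only [compl_mem_iff, inf_mem_iff]
  tauto

@[simp] theorem sdiff_mem_iff : a \ b ∈ x ↔ a ∈ x ∧ b ∉ x := by simp [sdiff_eq]

theorem mem_of_le (h : a ≤ b) (ha : a ∈ x) : b ∈ x := by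
  rw [← inf_eq_left.mpr h, inf_mem_iff] at ha
  exact ha.2

theorem finset_sup_mem_iff {ι : Type v} (t : Finset ι) (f : ι → α) :
    t.sup f ∈ x ↔ ∃ i ∈ t, f i ∈ x := by
  classical
  induction t using Finset.induction_on with
  | empty => simp
  | insert i t _ ih => simp [ih]

theorem exists_of_notMem (F : Set α) (htop : ⊤ ∈ F) (hinf : ∀ a ∈ F, ∀ b ∈ F, a ⊓ b ∈ F)
    (hup : ∀ a b, a ≤ b → a ∈ F → b ∈ F) (ha : a ∉ F) :
    ∃ x : Point α, F ⊆ x ∧ a ∉ x := by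
  have hF : Order.IsPFilter F := Order.IsPFilter.of_def ⟨⊤, htop⟩
    (fun a ha b hb => ⟨a ⊓ b, hinf a ha b hb, inf_le_left, inf_le_right⟩)
    (fun {a b} h ha => hup a b h ha)
  have hd : Disjoint (hF.toPFilter : Set α) (Order.Ideal.principal a : Set α) := by
    rw [Set.disjoint_left]
    intro b hb hba
    exact ha (hup b a hba hb)
  obtain ⟨J, hJ, haJ, hFJ⟩ := DistribLattice.prime_ideal_of_disjoint_filter_ideal hd
  refine ⟨⟨{b | b ∉ J}, hJ.toIsProper.top_notMem, fun b c => ?_, fun b => ?_⟩, ?_, ?_⟩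
  · constructor
    · exact fun h => ⟨fun hb => h (J.lower inf_le_left hb), fun hc => h (J.lower inf_le_right hc)⟩
    · exact fun h hbc => (hJ.mem_or_mem hbc).elim h.1 h.2
  · constructor
    · exact fun h h' => h (hJ.mem_or_compl_mem.resolve_left h')
    · intro h h'
      have h2 : b ∈ J := not_not.mp h
      have := J.sup_mem h2 h'
      rw [sup_compl_eq_top] at this
      exact hJ.toIsProper.top_notMem this
  · exact fun b hb hbJ => Set.disjoint_left.mp hFJ hb hbJ
  · exact not_not.mpr (haJ (Order.Ideal.mem_principal.mpr le_rfl))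

theorem le_iff_forall_mem : a ≤ b ↔ ∀ x : Point α, a ∈ x → b ∈ x := by
  refine ⟨fun h x => mem_of_le h, fun h => ?_⟩
  by_contra hab
  obtain ⟨x, hx, hb⟩ := exists_of_notMem (Set.Ici a) le_top (fun _ h _ h' => le_inf h h')
    (fun _ _ h h' => le_trans h' h) hab
  exact hb (h x (hx le_rfl))

/-- The canonical preorder on ultrafilters. -/
instance : Preorder (Point α) where
  le x y := ∀ a, int a ∈ x → int a ∈ y
  le_refl _ _ h := h
  le_trans _ _ _ h h' a ha := h' a (h a ha)

theorem le_def : x ≤ y ↔ ∀ a, int a ∈ x → int a ∈ y := Iff.rfl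

/-- The elements with interior in `x` form a filter; if `a` is outside it, the filter extends to an
ultrafilter above `x` that omits `a`. -/
theorem int_mem_iff : int a ∈ x ↔ ∀ y, x ≤ y → a ∈ y := by
  refine ⟨fun h y hy => mem_of_le (int_le a) (hy a h), fun h => ?_⟩
  by_contra ha
  obtain ⟨y, hy, hay⟩ := exists_of_notMem {b | int b ∈ x} (by simp [int_top])
    (fun b hb c hc => by simpa [int_inf] using ⟨hb, hc⟩)
    (fun b c h hb => mem_of_le (int_mono h) hb) ha
  exact hay (h y fun b hb => hy (by simpa [int_int] using hb))

theorem eq_of_le_of_le (hα : IsStarAlgebra α) (hxy : x ≤ y) (hyx : y ≤ x) : x = y := by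
  refine SetLike.ext fun a => hα.induction (p := fun a => a ∈ x ↔ a ∈ y) ?_ ?_ ?_ a
  · intro a ha
    rw [← ha]
    exact ⟨hxy a, hyx a⟩
  · intro a h; simp [h]
  · intro a b h h'; simp [h, h']

/-- The ultrafilters of depth at most `n`. -/
def depthLE : ℕ → Set (Point α)
  | 0 => ∅
  | n + 1 => {x | ∀ y, x ≤ y → y ≠ x → y ∈ depthLE n}

/-- Above an ultrafilter of depth greater than `m` there is a chain along which membership of some
element alternates `m` times. -/
theorem exists_alternating (hα : IsStarAlgebra α) (m : ℕ) (x : Point α) (hx : x ∉ depthLE m) :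
    ∃ f : ℕ → Point α, f 0 = x ∧ Monotone f ∧ ∃ a, ∀ j ≤ m, a ∈ f j ↔ Even j := by
  induction m generalizing x with
  | zero => exact ⟨fun _ => x, rfl, monotone_const, ⊤, by simp⟩
  | succ m ih =>
    have hx' : ∃ y, x ≤ y ∧ y ≠ x ∧ y ∉ depthLE m := by
      simpa [depthLE] using hx
    obtain ⟨y, hxy, hne, hy⟩ := hx'
    obtain ⟨f, hf0, hf, a, ha⟩ := ih y hy
    have hyx : ¬ y ≤ x := fun h => hne (eq_of_le_of_le hα h hxy)
    simp only [le_def, not_forall] at hyx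
    obtain ⟨u, huy, hux⟩ := hyx
    -- Prepending `x` shifts parity, hence the complement; meeting with `int u`, which holds from
    -- `y` on but not at `x`, puts `x` on the right side.
    refine ⟨fun n => Nat.casesOn n x f, rfl, monotone_nat_of_le_succ ?_, (a ⊓ int u)ᶜ, ?_⟩
    · rintro (_ | n)
      · change x ≤ f 0
        rwa [hf0]
      · exact hf n.le_succ
    · rintro (_ | j) hj
      · simp [hux]
      · have h1 : int u ∈ f j := hf (Nat.zero_le j) u (by rwa [hf0])
        simp [h1, ha j (by omega), Nat.even_add_one]

/-- A union of `n` differences of open elements alternates fewer than `2 * n` times. -/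
theorem lt_card_of_alternating {t : Finset (α × α)} (ht : ∀ p ∈ t, int p.1 = p.1 ∧ int p.2 = p.2)
    {f : ℕ → Point α} (hf : Monotone f) {n : ℕ}
    (h : ∀ j ≤ 2 * n, (t.sup fun p => p.1 \ p.2) ∈ f j ↔ Even j) : n < t.card := by
  have h1 : ∀ k : Fin (n + 1), ∃ p ∈ t, p.1 \ p.2 ∈ f (2 * k) := fun k => by
    rw [← finset_sup_mem_iff, h _ (by omega)]
    exact even_two_mul _
  choose g hgt hg using h1
  -- A difference of opens is convex along the chain: holding at `2k` and `2l`, it would also hold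
  -- at the odd index `2k + 1`.
  have key : ∀ k l : Fin (n + 1), k < l → g k ≠ g l := by
    intro k l hkl e
    obtain ⟨hu, hv⟩ := ht _ (hgt k)
    have hk := sdiff_mem_iff.mp (hg k)
    have hl := sdiff_mem_iff.mp (hg l)
    rw [← e] at hl
    have hkl' : (k : ℕ) < l := hkl
    have hu1 : (g k).1 ∈ f (2 * k + 1) := by
      rw [← hu] at hk ⊢
      exact hf (Nat.le_succ _) _ hk.1
    have hv1 : (g k).2 ∉ f (2 * k + 1) := by
      intro hv1
      rw [← hv] at hv1 hl
      exact hl.2 (hf (by omega) _ hv1)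
    have hodd := (h (2 * k + 1) (by omega)).mp
      ((finset_sup_mem_iff _ _).mpr ⟨g k, hgt k, sdiff_mem_iff.mpr ⟨hu1, hv1⟩⟩)
    exact absurd hodd (by simp)
  have inj : Function.Injective g := fun k l e => by
    rcases lt_trichotomy k l with hkl | hkl | hkl
    · exact absurd e (key k l hkl)
    · exact hkl
    · exact absurd e.symm (key l k hkl)
  have := Finset.card_le_card_of_injOn (s := Finset.univ) g (fun k _ => hgt k) inj.injOn
  simpa using this

theorem exists_depthLE_eq_univ (hα : IsStarAlgebra α) (hpow : IsStarAlgebra (ℕ → α)) :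
    ∃ m, (depthLE m : Set (Point α)) = Set.univ := by
  classical
  by_contra! hcon
  have h : ∀ m, ∃ f : ℕ → Point α, Monotone f ∧ ∃ a, ∀ j ≤ 2 * m, a ∈ f j ↔ Even j := by
    intro m
    obtain ⟨x, hx⟩ := (Set.ne_univ_iff_exists_notMem _).mp (hcon (2 * m))
    obtain ⟨f, -, hf⟩ := exists_alternating hα _ x hx
    exact ⟨f, hf⟩
  choose f hf a ha using h
  obtain ⟨t, ht⟩ := hpow.exists_sup_sdiff a
  -- Diagonal choice: coordinate `m` alternates too often for `m` differences.
  let m := t.card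
  let t' : Finset (α × α) := t.image fun p => (p.1.1 m, p.2.1 m)
  have e : a m = t'.sup fun p => p.1 \ p.2 := by
    rw [Finset.sup_image]
    conv_lhs => rw [ht]
    rw [Finset.sup_apply]
    rfl
  have h1 : m < t'.card := by
    refine lt_card_of_alternating ?_ (hf m) (n := m) ?_
    · intro p hp
      obtain ⟨q, -, rfl⟩ := Finset.mem_image.mp hp
      exact ⟨congrFun q.1.2 m, congrFun q.2.2 m⟩
    · rw [← e]
      exact ha m
  exact absurd Finset.card_image_le (not_le.mpr h1)

/-- An ultrafilter is determined by the generators it contains and the ultrafilters above and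
distinct from it: the elements on which two with equal data agree form a subalgebra. -/
theorem finite_depthLE {s : Set α} (hs : s.Finite) (hgen : generated s = Set.univ) (n : ℕ) :
    (depthLE n : Set (Point α)).Finite := by
  induction n with
  | zero => exact Set.finite_empty
  | succ n ih =>
    have := hs.to_subtype
    have := ih.to_subtype
    let F : (depthLE (n + 1) : Set (Point α)) → Set s × Set (depthLE n : Set (Point α)) :=
      fun x => ({a | a.1 ∈ x.1}, {y | x.1 ≤ y.1 ∧ y.1 ≠ x.1})
    have step : ∀ x y : (depthLE (n + 1) : Set (Point α)), F x = F y → ∀ a : α,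
        (a ∈ x.1 ↔ a ∈ y.1) → int a ∈ x.1 → int a ∈ y.1 := by
      intro x y e a ha hx
      rw [int_mem_iff]
      intro z hz
      by_cases hzy : z = y.1
      · rw [hzy, ← ha]
        exact mem_of_le (int_le a) hx
      · have hzn : z ∈ depthLE n := y.2 z hz hzy
        have h2 : (⟨z, hzn⟩ : (depthLE n : Set (Point α))) ∈ (F x).2 := by
          rw [e]
          exact ⟨hz, hzy⟩
        exact int_mem_iff.mp hx z h2.1
    have hF : Function.Injective F := by
      intro x y e
      have hS : IsSubalgebra {a | a ∈ x.1 ↔ a ∈ y.1} :=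
        { bot_mem := by simp
          top_mem := by simp
          sup_mem := fun {a b} ha hb => by simp_all
          inf_mem := fun {a b} ha hb => by simp_all
          compl_mem := fun {a} ha => by simp_all
          int_mem := fun {a} ha => ⟨step x y e a ha, step y x e.symm a ha.symm⟩ }
      have hs : s ⊆ {a | a ∈ x.1 ↔ a ∈ y.1} := fun a ha => by
        have := Set.ext_iff.mp (congrArg Prod.fst e) ⟨a, ha⟩
        exact this
      refine Subtype.ext (SetLike.ext fun a => generated_subset hS hs ?_)
      rw [hgen]
      trivial
    have := Finite.of_injective F hF
    exact Set.toFinite _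

theorem finite_of_finite [Finite (Point α)] : Finite α := by
  refine Finite.of_injective (fun a => {x : Point α | a ∈ x}) fun a b h => ?_
  have h' : ∀ x : Point α, a ∈ x ↔ b ∈ x := fun x => Set.ext_iff.mp h x
  exact le_antisymm (le_iff_forall_mem.mpr fun x => (h' x).mp)
    (le_iff_forall_mem.mpr fun x => (h' x).mpr)

end Point

theorem finite_of_isStarAlgebra {s : Set α} (hs : s.Finite) (hgen : generated s = Set.univ)
    (hα : IsStarAlgebra α) (hpow : IsStarAlgebra (ℕ → α)) : Finite α := by
  obtain ⟨m, hm⟩ := Point.exists_depthLE_eq_univ hα hpow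
  have h := Point.finite_depthLE hs hgen m
  rw [hm, Set.finite_univ_iff] at h
  exact Point.finite_of_finite

/-! ### The Grzegorczyk inequality -/

variable (α) in
/-- The Grzegorczyk inequality. -/
def IsGrz : Prop := ∀ a : α, int ((int (aᶜ ⊔ int a))ᶜ ⊔ a) ≤ a

/-- Relative to each nonempty closed set, here the complement of `w`, each element of a
`*`-algebra contains or omits a nonempty relatively open set. -/
theorem IsStarAlgebra.exists_isOpen (hα : IsStarAlgebra α) (a : α) :
    ∀ w : α, int w = w → w ≠ ⊤ →
      ∃ u, int u = u ∧ ¬ u ≤ w ∧ (u ≤ w ⊔ a ∨ u ≤ w ⊔ aᶜ) := by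
  refine hα.induction (p := fun a => ∀ w : α, int w = w → w ≠ ⊤ →
      ∃ u, int u = u ∧ ¬ u ≤ w ∧ (u ≤ w ⊔ a ∨ u ≤ w ⊔ aᶜ)) ?_ ?_ ?_ a
  · intro a ha w _ hw
    by_cases haw : a ≤ w
    · refine ⟨⊤, int_top, by rwa [top_le_iff], Or.inr ?_⟩
      calc ⊤ = a ⊔ aᶜ := sup_compl_eq_top.symm
        _ ≤ w ⊔ aᶜ := sup_le_sup_right haw _
    · exact ⟨a, ha, haw, Or.inl le_sup_right⟩
  · intro a h w hw hw'
    simpa [or_comm] using h w hw hw'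
  · intro a b ha hb w hw hw'
    obtain ⟨u, hu, huw, h1 | h1⟩ := ha w hw hw'
    · exact ⟨u, hu, huw, Or.inl (h1.trans (sup_le_sup_left le_sup_left _))⟩
    -- Now `u` omits `a` off `w`. The case of `b` is applied to the closure of `u` minus `w`, so
    -- that the open set found meets `u` outside `w`.
    have h2 : int (uᶜ ⊔ w) ≠ ⊤ := by
      intro h
      have h3 : ⊤ ≤ uᶜ ⊔ w := h.symm.le.trans (int_le _)
      refine huw (Point.le_iff_forall_mem.mpr fun x hx => ?_)
      have := Point.mem_of_le h3 (x := x) Point.top_mem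
      simp only [Point.sup_mem_iff, Point.compl_mem_iff] at this
      tauto
    obtain ⟨v, hv, hvw, h3⟩ := hb _ (int_int _) h2
    have h4 : ∀ c, v ≤ int (uᶜ ⊔ w) ⊔ c → v ≤ uᶜ ⊔ w ⊔ c :=
      fun c h => h.trans (sup_le_sup_right (int_le _) _)
    refine ⟨v ⊓ u, by rw [int_inf, hu, hv], fun h => hvw (le_int hv ?_), ?_⟩
    · rw [Point.le_iff_forall_mem] at h ⊢
      intro x hx
      have := h x
      simp only [Point.inf_mem_iff, Point.sup_mem_iff, Point.compl_mem_iff] at this ⊢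
      tauto
    · refine h3.imp (fun h => ?_) (fun h => ?_) <;>
      · have h := h4 _ h
        rw [Point.le_iff_forall_mem] at h h1 ⊢
        intro x hx
        have h := h x
        have h1 := h1 x
        simp only [Point.inf_mem_iff, Point.sup_mem_iff, Point.compl_mem_iff] at h h1 hx ⊢
        tauto

theorem IsStarAlgebra.isGrz (hα : IsStarAlgebra α) : IsGrz α := by
  intro a
  set d := int (aᶜ ⊔ int a) with hd
  set c := int (dᶜ ⊔ a) with hc
  have hcle : c ≤ dᶜ ⊔ a := int_le _
  have hco : int c = c := int_int _
  set w := int (cᶜ ⊔ a) with hw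
  by_contra hca
  have hw' : w ≠ ⊤ := by
    intro h
    have h1 : ⊤ ≤ cᶜ ⊔ a := h.symm.le.trans (int_le _)
    refine hca (Point.le_iff_forall_mem.mpr fun x hx => ?_)
    have := Point.mem_of_le h1 (x := x) Point.top_mem
    simp only [Point.sup_mem_iff, Point.compl_mem_iff] at this
    tauto
  have hcw : c ⊓ w ≤ int a := by
    rw [hw, ← hco, ← int_inf, hco]
    refine int_mono (Point.le_iff_forall_mem.mpr fun x => ?_)
    simp only [Point.inf_mem_iff, Point.sup_mem_iff, Point.compl_mem_iff]
    tauto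
  -- `w` is the Heyting implication from `c` to `a`: the largest open whose meet with `c` is below
  -- `a`. Either alternative of `exists_isOpen` will contradict this.
  have hqw : ∀ u, int u = u → u ⊓ c ≤ a → u ≤ w := by
    intro u hu h
    refine le_int hu ?_
    rw [Point.le_iff_forall_mem] at h ⊢
    intro x hx
    have h := h x
    simp only [Point.inf_mem_iff, Point.sup_mem_iff, Point.compl_mem_iff] at h ⊢
    tauto
  have hwle : w ≤ cᶜ ⊔ a := int_le _
  obtain ⟨u, hu, huw, h | h⟩ := hα.exists_isOpen a w (int_int _) hw'
  · refine huw (hqw u hu ?_)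
    rw [Point.le_iff_forall_mem] at h hwle ⊢
    intro x
    have h := h x
    have hwle := hwle x
    simp only [Point.inf_mem_iff, Point.sup_mem_iff, Point.compl_mem_iff] at h hwle ⊢
    tauto
  · refine huw (hqw u hu ?_)
    have hucd : u ⊓ c ≤ d := by
      refine le_int (by rw [int_inf, hu, hco]) ?_
      rw [Point.le_iff_forall_mem] at h hcw ⊢
      intro x
      have h := h x
      have hcw := hcw x
      simp only [Point.inf_mem_iff, Point.sup_mem_iff, Point.compl_mem_iff] at h hcw ⊢
      tauto
    rw [Point.le_iff_forall_mem] at hucd hcle ⊢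
    intro x
    have h := hucd x
    have hcle := hcle x
    simp only [Point.inf_mem_iff, Point.sup_mem_iff, Point.compl_mem_iff] at h hcle ⊢
    tauto

/-- Induction on `p`: an open `r` meets `p` and the closure of `p` in the same set, so `r ⊓ p` is a
difference of opens. The inequality at `pᶜ` makes it nonzero, so removing it leaves a smaller
element. -/
theorem IsGrz.mem_generated_of_finite (hα : IsGrz α) {S : Set α} (hS : IsSubalgebra S)
    (hfin : S.Finite) {p : α} (hp : p ∈ S) : p ∈ generated {a : α | int a = a} := by
  have hG := isSubalgebra_generated {a : α | int a = a}
  have hopen : ∀ a : α, int a ∈ generated {a : α | int a = a} :=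
    fun a => subset_generated _ (int_int a)
  have hwf : S.WellFoundedOn (· < ·) := hfin.wellFoundedOn
  refine hwf.induction hp fun p hp ih => ?_
  by_cases hp0 : p = ⊥
  · rw [hp0]
    exact hG.bot_mem
  have hr : int (p ⊔ int pᶜ) ⊓ (int pᶜ)ᶜ = int (p ⊔ int pᶜ) ⊓ p := by
    have h1 : int (p ⊔ int pᶜ) ≤ p ⊔ int pᶜ := int_le _
    have h2 : int pᶜ ≤ pᶜ := int_le _
    refine le_antisymm ?_ ?_ <;>
    · rw [Point.le_iff_forall_mem] at h1 h2 ⊢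
      intro x
      have h1 := h1 x
      have h2 := h2 x
      simp only [Point.inf_mem_iff, Point.sup_mem_iff, Point.compl_mem_iff] at h1 h2 ⊢
      tauto
  set r := int (p ⊔ int pᶜ) with hrdef
  have hrp : r ⊓ p ≠ ⊥ := by
    intro h
    have h1 := hα pᶜ
    rw [compl_compl, ← hrdef, ← compl_inf, h, compl_bot, int_top, top_le_iff] at h1
    exact hp0 (by simpa using h1)
  have hrS : r ∈ S := hS.int_mem (hS.sup_mem hp (hS.int_mem (hS.compl_mem hp)))
  have h1 : p ⊓ (r ⊓ p)ᶜ ∈ generated {a : α | int a = a} := by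
    refine ih _ (hS.inf_mem hp (hS.compl_mem (hS.inf_mem hrS hp))) (lt_of_le_of_ne inf_le_left ?_)
    intro h
    have h2 : r ⊓ p ≤ (r ⊓ p)ᶜ := inf_le_right.trans (inf_eq_left.mp h)
    exact hrp (le_compl_self.mp h2)
  have h2 : r ⊓ p ∈ generated {a : α | int a = a} := by
    rw [← hr]
    exact hG.inf_mem (hopen _) (hG.compl_mem (hopen _))
  have h3 : p = p ⊓ (r ⊓ p)ᶜ ⊔ r ⊓ p := by
    refine le_antisymm ?_ ?_ <;>
    · rw [Point.le_iff_forall_mem]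
      intro x
      simp only [Point.inf_mem_iff, Point.sup_mem_iff, Point.compl_mem_iff]
      tauto
  rw [h3]
  exact hG.sup_mem h1 h2

/-! ### Extension of Heyting homomorphisms -/

section Extension

variable {β : Type v} [InteriorAlgebra β]

theorem _root_.InteriorHom.eq_of_restrictOpens_eq (hα : IsStarAlgebra α) {g h : InteriorHom α β}
    (e : g.restrictOpens = h.restrictOpens) : g = h := by
  refine InteriorHom.ext (DFunLike.ext _ _ fun a => hα.induction
    (p := fun a => g.toBoundedLatticeHom a = h.toBoundedLatticeHom a) ?_ ?_ ?_ a)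
  · intro a ha
    exact congrArg Subtype.val (DFunLike.congr_fun e (⟨a, ha⟩ : Opens α))
  · intro a ha
    rw [map_compl', map_compl', ha]
  · intro a b ha hb
    rw [map_sup, map_sup, ha, hb]

/-- The graph of a Heyting homomorphism between the algebras of open elements. -/
def opensGraph (f : HeytingHom (Opens α) (Opens β)) : Set (α × β) :=
  Set.range fun u => (u.1, (f u).1)

variable (f : HeytingHom (Opens α) (Opens β))

theorem isSublattice_opensGraph : IsSublattice (opensGraph f) where
  supClosed := by
    rintro _ ⟨u, rfl⟩ _ ⟨v, rfl⟩
    refine ⟨u ⊔ v, Prod.ext rfl ?_⟩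
    change (f (u ⊔ v)).1 = (f u ⊔ f v).1
    rw [map_sup]
  infClosed := by
    rintro _ ⟨u, rfl⟩ _ ⟨v, rfl⟩
    refine ⟨u ⊓ v, Prod.ext rfl ?_⟩
    change (f (u ⊓ v)).1 = (f u ⊓ f v).1
    rw [map_inf]

theorem bot_mem_opensGraph : ⊥ ∈ opensGraph f :=
  ⟨⊥, Prod.ext rfl (congrArg Subtype.val (map_bot f))⟩

theorem top_mem_opensGraph : ⊤ ∈ opensGraph f :=
  ⟨⊤, Prod.ext rfl (congrArg Subtype.val (map_top f))⟩

/-- Applied to differences, this makes the Boolean closure of the graph single-valued. It holds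
because `u \ v = ⊥` means `u ≤ v`, which `f` preserves. -/
theorem snd_eq_bot_of_mem_closure {x : α × β}
    (hx : x ∈ BooleanSubalgebra.closure (opensGraph f)) : x.1 = ⊥ → x.2 = ⊥ := by
  refine BooleanSubalgebra.closure_sdiff_sup_induction (p := fun x _ => x.1 = ⊥ → x.2 = ⊥)
    (isSublattice_opensGraph f) (bot_mem_opensGraph f) (top_mem_opensGraph f) ?_ ?_ x hx
  · rintro _ ⟨u, rfl⟩ _ ⟨v, rfl⟩ h
    have h1 : u ≤ v := sdiff_eq_bot_iff.mp h
    exact sdiff_eq_bot_iff.mpr (OrderHomClass.mono f h1)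
  · intro x _ y _ hx hy h
    have h' := sup_eq_bot_iff.mp (h : x.1 ⊔ y.1 = ⊥)
    exact sup_eq_bot_iff.mpr ⟨hx h'.1, hy h'.2⟩

/-- The interior of the complement of a join of differences `u \ v` is the meet of the implications
`u ⇨ v`, which `f` preserves. -/
theorem exists_int_of_mem_closure {x : α × β}
    (hx : x ∈ BooleanSubalgebra.closure (opensGraph f)) :
    ∃ u : Opens α, u.1 = int x.1 ∧ (f u).1 = int x.2 := by
  have key : ∀ x ∈ BooleanSubalgebra.closure (opensGraph f),
      ∃ u : Opens α, u.1 = int x.1ᶜ ∧ (f u).1 = int x.2ᶜ := by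
    intro x hx
    refine BooleanSubalgebra.closure_sdiff_sup_induction
      (p := fun x _ => ∃ u : Opens α, u.1 = int x.1ᶜ ∧ (f u).1 = int x.2ᶜ)
      (isSublattice_opensGraph f) (bot_mem_opensGraph f) (top_mem_opensGraph f) ?_ ?_ x hx
    · rintro _ ⟨u, rfl⟩ _ ⟨v, rfl⟩
      refine ⟨u ⇨ v, ?_, ?_⟩
      · change int (u.1ᶜ ⊔ v.1) = int (u.1 \ v.1)ᶜ
        rw [sdiff_eq, compl_inf, compl_compl]
      · rw [map_himp]
        change int ((f u).1ᶜ ⊔ (f v).1) = int ((f u).1 \ (f v).1)ᶜ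
        rw [sdiff_eq, compl_inf, compl_compl]
    · rintro x _ y _ ⟨u, hu, hu'⟩ ⟨v, hv, hv'⟩
      refine ⟨u ⊓ v, ?_, ?_⟩
      · change u.1 ⊓ v.1 = int (x.1 ⊔ y.1)ᶜ
        rw [hu, hv, compl_sup, int_inf]
      · rw [map_inf]
        change (f u).1 ⊓ (f v).1 = int (x.2 ⊔ y.2)ᶜ
        rw [hu', hv', compl_sup, int_inf]
  simpa using key xᶜ (BooleanSubalgebra.compl_mem hx)

theorem eq_of_mem_closure {a : α} {b c : β}
    (hb : (a, b) ∈ BooleanSubalgebra.closure (opensGraph f))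
    (hc : (a, c) ∈ BooleanSubalgebra.closure (opensGraph f)) : b = c := by
  have h1 := snd_eq_bot_of_mem_closure f (BooleanSubalgebra.sdiff_mem hb hc) sdiff_self
  have h2 := snd_eq_bot_of_mem_closure f (BooleanSubalgebra.sdiff_mem hc hb) sdiff_self
  exact le_antisymm (sdiff_eq_bot_iff.mp h1) (sdiff_eq_bot_iff.mp h2)

theorem IsStarAlgebra.exists_mem_closure (hα : IsStarAlgebra α) (a : α) :
    ∃ b, (a, b) ∈ BooleanSubalgebra.closure (opensGraph f) := by
  refine hα.induction
    (p := fun a => ∃ b, (a, b) ∈ BooleanSubalgebra.closure (opensGraph f)) ?_ ?_ ?_ a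
  · exact fun u hu => ⟨_, BooleanSubalgebra.subset_closure ⟨⟨u, hu⟩, rfl⟩⟩
  · rintro a ⟨b, h⟩
    exact ⟨_, BooleanSubalgebra.compl_mem h⟩
  · rintro a c ⟨b, h⟩ ⟨d, h'⟩
    exact ⟨_, BooleanSubalgebra.sup_mem h h'⟩

/-- A Heyting homomorphism between algebras of open elements extends to the interior algebras
if the source is a `*`-algebra. -/
theorem IsStarAlgebra.exists_restrictOpens_eq (hα : IsStarAlgebra α) :
    ∃ h : InteriorHom α β, h.restrictOpens = f := by
  choose h hh using hα.exists_mem_closure f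
  have uniq : ∀ {a b}, (a, b) ∈ BooleanSubalgebra.closure (opensGraph f) → h a = b :=
    fun H => eq_of_mem_closure f (hh _) H
  have hopen : ∀ u : Opens α, h u.1 = (f u).1 :=
    fun u => uniq (BooleanSubalgebra.subset_closure ⟨u, rfl⟩)
  refine ⟨{ toFun := h
            map_sup' := fun a b => uniq (BooleanSubalgebra.sup_mem (hh a) (hh b))
            map_inf' := fun a b => uniq (BooleanSubalgebra.inf_mem (hh a) (hh b))
            map_top' := uniq BooleanSubalgebra.top_mem
            map_bot' := uniq BooleanSubalgebra.bot_mem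
            map_int' := fun a => ?_ }, ?_⟩
  · obtain ⟨u, hu, hu'⟩ := exists_int_of_mem_closure f (hh a)
    rw [← hu', ← hopen, hu]
  · exact DFunLike.ext _ _ fun u => Subtype.ext (hopen u)

end Extension

/-- The open elements of the subalgebra generated by the open elements. -/
def opensToGenerated :
    HeytingHom (Opens α) (Opens (generatedSubalgebra {a : α | int a = a})) where
  toFun u := ⟨⟨u.1, subset_generated _ u.2⟩, Subtype.ext u.2⟩
  map_sup' _ _ := rfl
  map_inf' _ _ := rfl
  map_bot' := rfl
  map_himp' _ _ := rfl

/-- `h` is injective, because it fixes opens and `a ≤ b` says that `int (aᶜ ⊔ b)` is `⊤`. It is also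
a retraction onto the generated subalgebra, so it moves nothing. -/
theorem isStarAlgebra_of_restrictOpens_eq
    (h : InteriorHom α (generatedSubalgebra {a : α | int a = a}))
    (hh : h.restrictOpens = opensToGenerated) : IsStarAlgebra α := by
  have hopen : ∀ u : α, ∀ hu : int u = u, h.toBoundedLatticeHom u = ⟨u, subset_generated _ hu⟩ :=
    fun u hu => congrArg Subtype.val (DFunLike.congr_fun hh (⟨u, hu⟩ : Opens α))
  have hle : ∀ a b : α, h.toBoundedLatticeHom a = h.toBoundedLatticeHom b → a ≤ b := by
    intro a b hab
    have h1 : h.toBoundedLatticeHom (int (aᶜ ⊔ b)) = ⊤ := by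
      rw [h.map_int, map_sup, map_compl', hab, compl_sup_eq_top, int_top]
    rw [hopen _ (int_int _)] at h1
    have h2 : int (aᶜ ⊔ b) = ⊤ := congrArg Subtype.val h1
    have h3 : ⊤ ≤ aᶜ ⊔ b := h2.symm.le.trans (int_le _)
    rwa [top_le_iff, sup_comm, ← himp_eq, himp_eq_top_iff] at h3
  have hid : h.comp (generatedInclusion _) = InteriorHom.id _ := by
    refine InteriorHom.eq_of_restrictOpens_eq isStarAlgebra_generatedSubalgebra ?_
    refine DFunLike.ext _ _ fun u => Subtype.ext ?_
    exact hopen u.1.1 (congrArg Subtype.val u.2)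
  refine Set.eq_univ_of_forall fun a => ?_
  have h1 : h.toBoundedLatticeHom (h.toBoundedLatticeHom a).1 = h.toBoundedLatticeHom a :=
    congrArg (fun g => g.toBoundedLatticeHom (h.toBoundedLatticeHom a)) hid
  rw [← le_antisymm (hle _ _ h1) (hle _ _ h1.symm)]
  exact (h.toBoundedLatticeHom a).2

end InteriorAlgebra

/-! ### Varieties and the functor of open elements -/

namespace IntAlg

open InteriorAlgebra

theorem Term.map_eval {α : Type u} {β : Type v} [InteriorAlgebra α] [InteriorAlgebra β]
    (f : InteriorHom α β) (x : ℕ → α) (t : Term) :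
    f.toBoundedLatticeHom (t.eval x) = t.eval fun n => f.toBoundedLatticeHom (x n) := by
  induction t with
  | var n => rfl
  | bot => exact map_bot _
  | top => exact map_top _
  | sup s t hs ht => simp only [Term.eval, map_sup, hs, ht]
  | inf s t hs ht => simp only [Term.eval, map_inf, hs, ht]
  | compl t ht => simp only [Term.eval, map_compl', ht]
  | int t ht => simp only [Term.eval, InteriorHom.map_int, ht]

/-- A variety contains each algebra whose elements are separated by homomorphisms into its
members. -/
theorem IsVariety.of_separating {V : ObjectProperty IntAlg.{u}} (hV : IsVariety V)
    {A : IntAlg.{u}} {ι : Type v} (B : ι → IntAlg.{u}) (hB : ∀ i, V (B i))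
    (f : ∀ i, InteriorHom A (B i))
    (hf : ∀ a b : A, (∀ i, (f i).toBoundedLatticeHom a = (f i).toBoundedLatticeHom b) → a = b) :
    V A := by
  obtain ⟨E, hE⟩ := hV
  refine (hE A).mpr fun e he x => hf _ _ fun i => ?_
  rw [Term.map_eval, Term.map_eval]
  exact (hE (B i)).mp (hB i) e he _

theorem IsVariety.generatedSubalgebra {V : ObjectProperty IntAlg.{u}} (hV : IsVariety V)
    {A : IntAlg.{u}} (hA : V A) (s : Set A) :
    V ⟨InteriorAlgebra.generatedSubalgebra s⟩ :=
  hV.of_separating (fun _ : Unit => A) (fun _ => hA) (fun _ => generatedInclusion s)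
    fun _ _ h => Subtype.ext (h ())

theorem IsVariety.pi {V : ObjectProperty IntAlg.{u}} (hV : IsVariety V)
    {A : IntAlg.{u}} (hA : V A) : V ⟨ℕ → A⟩ :=
  hV.of_separating (fun _ : ℕ => A) (fun _ => hA) (fun i => evalHom i) fun _ _ h => funext h

theorem isVariety_isGrz : IsVariety fun A : IntAlg.{u} => IsGrz A := by
  let v : Term := .var 0
  let g : Term := .int (.sup (.compl (.int (.sup (.compl v) (.int v)))) v)
  -- The inequality `g ≤ v` as an identity.
  refine ⟨{(.inf g v, g)}, fun A => ?_⟩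
  simp only [Set.mem_singleton_iff, forall_eq]
  exact ⟨fun h x => inf_eq_left.mpr (h (x 0)), fun h a => inf_eq_left.mp (h fun _ => a)⟩

theorem isStarAlgebra_of_isLocallyFinite {V : ObjectProperty IntAlg.{u}}
    (hfin : IsLocallyFinite V) (hstar : IsStarVariety V) {A : IntAlg.{u}} (hA : V A) :
    IsStarAlgebra A := by
  have hA' : starPart V A := by
    rw [← hstar]
    exact hA
  have hG : IsGrz A := hA' _ isVariety_isGrz fun _ hB => hB.2.isGrz
  exact Set.eq_univ_of_forall fun a => hG.mem_generated_of_finite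
    (isSubalgebra_generated {a}) (hfin A hA {a} (Set.finite_singleton a))
    (subset_generated _ rfl)

theorem full_of_isStarAlgebra {V : ObjectProperty IntAlg.{u}}
    (h : ∀ A, V A → IsStarAlgebra A) : (V.ι ⋙ openFunctor).Full where
  map_surjective {X Y} f := by
    obtain ⟨g, hg⟩ := (h X.obj X.property).exists_restrictOpens_eq f.hom
    exact ⟨ObjectProperty.homMk g, HeytAlg.hom_ext hg⟩

theorem faithful_of_isStarAlgebra {V : ObjectProperty IntAlg.{u}}
    (h : ∀ A, V A → IsStarAlgebra A) : (V.ι ⋙ openFunctor).Faithful where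
  map_injective {X _} _ _ e := ObjectProperty.hom_ext _
    (InteriorHom.eq_of_restrictOpens_eq (h X.obj X.property) (congrArg HeytAlg.Hom.hom e))

theorem isStarAlgebra_of_full {V : ObjectProperty IntAlg.{u}} (hV : IsVariety V)
    (hfull : (V.ι ⋙ openFunctor).Full) {A : IntAlg.{u}} (hA : V A) : IsStarAlgebra A := by
  let X : V.FullSubcategory := ⟨A, hA⟩
  let Y : V.FullSubcategory := ⟨_, hV.generatedSubalgebra hA {a : A | InteriorAlgebra.int a = a}⟩
  obtain ⟨h, hh⟩ := hfull.map_surjective (X := X) (Y := Y) (HeytAlg.ofHom opensToGenerated)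
  exact isStarAlgebra_of_restrictOpens_eq h.hom (congrArg HeytAlg.Hom.hom hh)

theorem isStarVariety_of_isStarAlgebra {V : ObjectProperty IntAlg.{u}} (hV : IsVariety V)
    (h : ∀ A, V A → IsStarAlgebra A) : IsStarVariety V := by
  refine funext fun A => propext ⟨fun hA W _ hW => hW A ⟨hA, h A hA⟩, fun hA => ?_⟩
  exact hA V hV fun _ hB => hB.1

theorem isLocallyFinite_of_isStarAlgebra {V : ObjectProperty IntAlg.{u}} (hV : IsVariety V)
    (h : ∀ A, V A → IsStarAlgebra A) : IsLocallyFinite V := by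
  intro A hA s hs
  have hB := hV.generatedSubalgebra hA s
  have : Finite (InteriorAlgebra.generatedSubalgebra s) :=
    finite_of_isStarAlgebra (hs.preimage Subtype.val_injective.injOn) (generated_preimage s)
      (h _ hB) (h _ (hV.pi hB))
  exact Set.toFinite (InteriorAlgebra.generatedSubalgebra s : Set A)

end IntAlg

theorem mainTheorem4 (V : ObjectProperty IntAlg.{u}) (hV : IntAlg.IsVariety V) :
    ((V.ι ⋙ IntAlg.openFunctor).Full ↔
        (IntAlg.IsLocallyFinite V ∧ IntAlg.IsStarVariety V)) ∧
      (IntAlg.IsLocallyFinite V ∧ IntAlg.IsStarVariety V →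
        CategoricallyEquivalent V.FullSubcategory (IntAlg.gamma V).FullSubcategory) := by
  have star (h : IntAlg.IsLocallyFinite V ∧ IntAlg.IsStarVariety V) :
      ∀ A, V A → InteriorAlgebra.IsStarAlgebra A :=
    fun _ hA => IntAlg.isStarAlgebra_of_isLocallyFinite h.1 h.2 hA
  refine ⟨⟨fun hfull => ?_, fun h => IntAlg.full_of_isStarAlgebra (star h)⟩, fun h => ?_⟩
  · have hstar : ∀ A, V A → InteriorAlgebra.IsStarAlgebra A :=
      fun _ hA => IntAlg.isStarAlgebra_of_full hV hfull hA
    exact ⟨IntAlg.isLocallyFinite_of_isStarAlgebra hV hstar,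
      IntAlg.isStarVariety_of_isStarAlgebra hV hstar⟩
  · have hfull := IntAlg.full_of_isStarAlgebra (star h)
    have hfaithful := IntAlg.faithful_of_isStarAlgebra (star h)
    have hF (X : V.FullSubcategory) : IntAlg.gamma V ((V.ι ⋙ IntAlg.openFunctor).obj X) :=
      ⟨X.obj, X.property, ⟨Iso.refl _⟩⟩
    -- The functor of opens with codomain cut down to `gamma V`; it is essentially surjective by the
    -- definition of `gamma`.
    refine ⟨(IntAlg.gamma V).lift (V.ι ⋙ IntAlg.openFunctor) hF,
      Functor.Full.of_comp_faithful_iso ((IntAlg.gamma V).liftCompιIso _ hF),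
      Functor.Faithful.of_comp_iso ((IntAlg.gamma V).liftCompιIso _ hF), fun d => ?_⟩
    obtain ⟨A, hA, ⟨e⟩⟩ := d.property
    exact ⟨⟨A, hA⟩, ⟨(IntAlg.gamma V).isoMk e⟩⟩
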